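/- For a real Banach space $X$, a slice of the closed unit ball $B_X$ is a set $S(x^*,\alpha)=\{y\in B_X: x^*(y)>\sup x^*(B_X)-\alpha\}$ with $x^*\in X^*$ and $\alpha>0$. A point $x$ of the unit sphere $S_X$ is a Daugavet-point if $\sup_{y\in S}\|x-y\|=2$ for every slice $S$ of $B_X$. It is a relative Daugavet-point if there are $x^*\in X^*$ with $\|x^*\|=x^*(x)=1$ and $\alpha>0$ such that $\sup_{y\in T}\|x-y\|=2$ for every slice $T$ of $B_X$ contained in $S(x^*,\alpha)$. The space $X$ has the Daugavet property (respectively, the relative Daugavet property) if every point of $S_X$ is a Daugavet-point (respectively, a relative Daugavet-point). A norm $N$ on $\mathbb R^2$ is absolute if $N(a,b)=N(|a|,|b|)$ for all $a,b$, and normalized if $N(1,0)=N(0,1)=1$. It is polyhedral if its unit ball is an intersection of finitely many closed half-planes. An absolute normalized norm $N$ has property $(\alpha)$ if for all $a,b\ge 0$ with $N(a,b)=1$ there are $\varepsilon>0$ and a neighbourhood $W$ of $(a,b)$ with $\sup_{(c,d)\in W}c<1$ or $\sup_{(c,d)\in W}d<1$, such that $(c,d)\in W$ for all $c,d\ge 0$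 with $N(c,d)=1$ and $N((a,b)+(c,d))\ge 2-\varepsilon$. $X\oplus_N Y$ denotes $X\times Y$ with the norm $\|(x,y)\|=N(\|x\|,\|y\|)$. Corollary. There exists a nonzero Banach space with the relative Daugavet property that contains no Daugavet-point. More precisely: (1) If $X$ and $Y$ are nonzero Banach spaces with the relative Daugavet property and $N$ is a polyhedral absolute normalized norm on $\mathbb R^2$ with property $(\alpha)$, then $X\oplus_N Y$ is a Banach space with the relative Daugavet property that contains no Daugavet-point. (2) Every Banach space with the Daugavet property has the relative Daugavet property; in particular, (1) applies to nonzero $X$ and $Y$ with the Daugavet property. (3) Polyhedral absolute normalized norms on $\mathbb R^2$ with property $(\alpha)$ exist, and so do nonzero Banach spaces with the Daugavet property. -/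

import Mathlib

open Topology

universe u v

/-! ### Slices and (relative) Daugavet-points -/

/-- The slice `S(f, α) = {x ∈ B_X : f x > sup f(B_X) - α}` of the closed unit ball;
the supremum `sup f(B_X)` is `‖f‖`, see `isLUB_image_closedBall`. -/
def slice {X : Type*} [NormedAddCommGroup X] [NormedSpace ℝ X]
    (f : StrongDual ℝ X) (α : ℝ) : Set X :=
  {x | ‖x‖ ≤ 1 ∧ ‖f‖ - α < f x}

theorem isLUB_image_closedBall {X : Type*} [NormedAddCommGroup X] [NormedSpace ℝ X]
    (f : StrongDual ℝ X) : IsLUB (f '' Metric.closedBall 0 1) ‖f‖ := by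
  refine ⟨?_, fun b hb => ?_⟩
  · rintro _ ⟨x, hx, rfl⟩
    rw [mem_closedBall_zero_iff] at hx
    exact (le_abs_self _).trans (f.unit_le_opNorm x hx)
  · have hb0 : 0 ≤ b := by
      have := hb ⟨0, by simp, rfl⟩
      simpa using this
    refine f.opNorm_le_of_unit_norm hb0 fun x hx => ?_
    have h1 : f x ≤ b := hb ⟨x, by simp [hx], rfl⟩
    have h2 : f (-x) ≤ b := hb ⟨-x, by simp [hx], rfl⟩
    rw [map_neg] at h2
    rw [Real.norm_eq_abs]
    exact abs_le.2 ⟨by linarith, h1⟩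

/-- `x ∈ S_X` is a Daugavet-point: `sup_{y ∈ S} ‖x - y‖ = 2` for every slice `S` of `B_X`. -/
def IsDaugavetPoint {X : Type*} [NormedAddCommGroup X] [NormedSpace ℝ X] (x : X) : Prop :=
  ‖x‖ = 1 ∧ ∀ (g : StrongDual ℝ X) (β : ℝ), 0 < β →
    IsLUB ((fun y => ‖x - y‖) '' slice g β) 2

/-- `x` is a Daugavet-point relative to the set `S` (a slice): `sup_{y ∈ T} ‖x - y‖ = 2` for
every slice `T` of `B_X` contained in `S`. -/
def IsDaugavetRelativeTo {X : Type*} [NormedAddCommGroup X] [NormedSpace ℝ X]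
    (x : X) (S : Set X) : Prop :=
  ∀ (g : StrongDual ℝ X) (β : ℝ), 0 < β → slice g β ⊆ S →
    IsLUB ((fun y => ‖x - y‖) '' slice g β) 2

/-- `x ∈ S_X` is a relative Daugavet-point: it is a Daugavet-point relative to some slice
defined by a norm-one functional supporting at `x`. -/
def IsRelativeDaugavetPoint {X : Type*} [NormedAddCommGroup X] [NormedSpace ℝ X]
    (x : X) : Prop :=
  ‖x‖ = 1 ∧ ∃ (f : StrongDual ℝ X) (α : ℝ), ‖f‖ = 1 ∧ f x = 1 ∧ 0 < α ∧
    IsDaugavetRelativeTo x (slice f α)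

/-- Every point of the unit sphere is a Daugavet-point. -/
def DaugavetProperty (X : Type*) [NormedAddCommGroup X] [NormedSpace ℝ X] : Prop :=
  ∀ x : X, ‖x‖ = 1 → IsDaugavetPoint x

/-- Every point of the unit sphere is a relative Daugavet-point. -/
def RelativeDaugavetProperty (X : Type*) [NormedAddCommGroup X] [NormedSpace ℝ X] : Prop :=
  ∀ x : X, ‖x‖ = 1 → IsRelativeDaugavetPoint x

/-! ### Absolute normalized norms on the plane -/

/-- An absolute normalized norm on `ℝ²`. -/
structure AbsNorm extends Seminorm ℝ (ℝ × ℝ) where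
  eq_zero' : ∀ p, toFun p = 0 → p = 0
  absolute' : ∀ a b : ℝ, toFun (a, b) = toFun (|a|, |b|)
  normalized_fst' : toFun (1, 0) = 1
  normalized_snd' : toFun (0, 1) = 1

namespace AbsNorm

instance : CoeFun AbsNorm (fun _ => ℝ × ℝ → ℝ) := ⟨fun N => N.toSeminorm⟩

/-- The unit ball of `(ℝ², N)` is the intersection of finitely many closed half-planes. -/
def IsPolyhedral (N : AbsNorm) : Prop :=
  ∃ H : Finset (StrongDual ℝ (ℝ × ℝ) × ℝ), (∀ h ∈ H, h.1 ≠ 0) ∧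
    {p : ℝ × ℝ | N p ≤ 1} = ⋂ h ∈ H, {p : ℝ × ℝ | h.1 p ≤ h.2}

/-- Property `(α)`: for all `a, b ≥ 0` with `N (a, b) = 1` there are `ε > 0` and a neighbourhood
`W` of `(a, b)` such that `sup_{(c,d) ∈ W} c < 1` or `sup_{(c,d) ∈ W} d < 1`, and `W` contains
all `(c, d)` with `c, d ≥ 0`, `N (c, d) = 1` and `N ((a, b) + (c, d)) ≥ 2 - ε`. -/
def PropertyAlpha (N : AbsNorm) : Prop :=
  ∀ a b : ℝ, 0 ≤ a → 0 ≤ b → N (a, b) = 1 →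
    ∃ ε : ℝ, 0 < ε ∧ ∃ W ∈ 𝓝 (a, b),
      ((∃ s < 1, ∀ p ∈ W, p.1 ≤ s) ∨ (∃ s < 1, ∀ p ∈ W, p.2 ≤ s)) ∧
      ∀ c d : ℝ, 0 ≤ c → 0 ≤ d → N (c, d) = 1 → 2 - ε ≤ N (a + c, b + d) → (c, d) ∈ W

theorem mono_fst (N : AbsNorm) {a c : ℝ} (b : ℝ) (ha : 0 ≤ a) (hac : a ≤ c) :
    N (a, b) ≤ N (c, b) := by
  rcases ha.eq_or_lt with rfl | ha
  · have h1 : N (-c, b) = N (c, b) := by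
      have e1 : N (-c, b) = N (|(-c)|, |b|) := N.absolute' (-c) b
      have e2 : N (c, b) = N (|c|, |b|) := N.absolute' c b
      rw [e1, e2, abs_neg]
    have h2 : N ((c, b) + (-c, b)) ≤ N (c, b) + N (-c, b) := map_add_le_add N.toSeminorm _ _
    have h3 : ((c, b) + (-c, b) : ℝ × ℝ) = (2 : ℝ) • ((0, b) : ℝ × ℝ) := by
      ext <;> simp; ring
    rw [h3] at h2
    have h4 : N ((2 : ℝ) • ((0, b) : ℝ × ℝ)) = 2 * N (0, b) := by
      have := map_smul_eq_mul N.toSeminorm (2 : ℝ) ((0, b) : ℝ × ℝ)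
      simpa using this
    linarith
  · have hc : 0 < c := ha.trans_le hac
    have h1 : N (-c, b) = N (c, b) := by
      have e1 : N (-c, b) = N (|(-c)|, |b|) := N.absolute' (-c) b
      have e2 : N (c, b) = N (|c|, |b|) := N.absolute' c b
      rw [e1, e2, abs_neg]
    set t : ℝ := (c + a) / (2 * c) with ht
    have ht0 : 0 ≤ t := by positivity
    have ht1 : t ≤ 1 := by rw [ht, div_le_one (by positivity)]; linarith
    have h3 : ((a, b) : ℝ × ℝ) = t • ((c, b) : ℝ × ℝ) + (1 - t) • ((-c, b) : ℝ × ℝ) := by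
      ext
      · simp [ht]; field_simp; ring
      · simp; ring
    have h2 : N (t • ((c, b) : ℝ × ℝ) + (1 - t) • ((-c, b) : ℝ × ℝ)) ≤
        N (t • ((c, b) : ℝ × ℝ)) + N ((1 - t) • ((-c, b) : ℝ × ℝ)) :=
      map_add_le_add N.toSeminorm _ _
    have h4 : N (t • ((c, b) : ℝ × ℝ)) = t * N (c, b) := by
      have := map_smul_eq_mul N.toSeminorm t ((c, b) : ℝ × ℝ)
      rwa [Real.norm_of_nonneg ht0] at this
    have h5 : N ((1 - t) • ((-c, b) : ℝ × ℝ)) = (1 - t) * N (-c, b) := by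
      have := map_smul_eq_mul N.toSeminorm (1 - t) ((-c, b) : ℝ × ℝ)
      rwa [Real.norm_of_nonneg (by linarith)] at this
    rw [← h3, h4, h5, h1] at h2
    linarith

theorem mono_snd (N : AbsNorm) (a : ℝ) {b d : ℝ} (hb : 0 ≤ b) (hbd : b ≤ d) :
    N (a, b) ≤ N (a, d) := by
  let M : AbsNorm :=
    { toSeminorm := N.toSeminorm.comp (LinearEquiv.prodComm ℝ ℝ ℝ).toLinearMap
      eq_zero' := fun p hp => by
        have := N.eq_zero' (p.2, p.1) hp
        simp only [Prod.mk_eq_zero] at this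
        exact Prod.ext this.2 this.1
      absolute' := fun a b => N.absolute' b a
      normalized_fst' := N.normalized_snd'
      normalized_snd' := N.normalized_fst' }
  exact M.mono_fst a hb hbd

end AbsNorm

/-! ### The absolute sum of two normed spaces -/

/-- The absolute sum `X ⊕_N Y`: the vector space `X × Y` with the norm `N (‖x‖, ‖y‖)`. -/
def AbsSum (_N : AbsNorm) (X Y : Type*) : Type _ := X × Y

namespace AbsSum

section

variable (N : AbsNorm) (X Y : Type*) [NormedAddCommGroup X] [NormedSpace ℝ X]
  [NormedAddCommGroup Y] [NormedSpace ℝ Y]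

instance instAddCommGroup : AddCommGroup (AbsSum N X Y) := inferInstanceAs (AddCommGroup (X × Y))

instance instModule : Module ℝ (AbsSum N X Y) := inferInstanceAs (Module ℝ (X × Y))

instance instNorm : Norm (AbsSum N X Y) := ⟨fun z => N (‖z.1‖, ‖z.2‖)⟩

theorem core : NormedSpace.Core ℝ (AbsSum N X Y) where
  norm_nonneg z := apply_nonneg N.toSeminorm _
  norm_smul c z := by
    change N (‖c • z.1‖, ‖c • z.2‖) = ‖c‖ * N (‖z.1‖, ‖z.2‖)
    rw [norm_smul, norm_smul]
    have := map_smul_eq_mul N.toSeminorm ‖c‖ (‖z.1‖, ‖z.2‖)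
    rwa [norm_norm] at this
  norm_triangle z w := by
    change N (‖z.1 + w.1‖, ‖z.2 + w.2‖) ≤ N (‖z.1‖, ‖z.2‖) + N (‖w.1‖, ‖w.2‖)
    calc N (‖z.1 + w.1‖, ‖z.2 + w.2‖)
        ≤ N (‖z.1‖ + ‖w.1‖, ‖z.2 + w.2‖) := N.mono_fst _ (norm_nonneg _) (norm_add_le _ _)
      _ ≤ N (‖z.1‖ + ‖w.1‖, ‖z.2‖ + ‖w.2‖) := N.mono_snd _ (norm_nonneg _) (norm_add_le _ _)
      _ ≤ _ := map_add_le_add N.toSeminorm (‖z.1‖, ‖z.2‖) (‖w.1‖, ‖w.2‖)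
  norm_eq_zero_iff z := by
    constructor
    · intro h
      have h0 : ((‖z.1‖, ‖z.2‖) : ℝ × ℝ) = 0 := N.eq_zero' _ h
      simp only [Prod.mk_eq_zero, norm_eq_zero] at h0
      exact Prod.ext h0.1 h0.2
    · rintro rfl
      change N (‖(0 : X)‖, ‖(0 : Y)‖) = 0
      rw [norm_zero, norm_zero]
      exact map_zero N.toSeminorm

noncomputable instance instNormedAddCommGroup : NormedAddCommGroup (AbsSum N X Y) :=
  NormedAddCommGroup.ofCore (core N X Y)

noncomputable instance instNormedSpace : NormedSpace ℝ (AbsSum N X Y) :=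
  NormedSpace.ofCore (core N X Y)

end

theorem norm_def (N : AbsNorm) {X Y : Type*} [NormedAddCommGroup X] [NormedSpace ℝ X]
    [NormedAddCommGroup Y] [NormedSpace ℝ Y] (z : AbsSum N X Y) :
    @norm _ (instNormedAddCommGroup N X Y).toNorm z = N (‖z.1‖, ‖z.2‖) := rfl

end AbsSum

/-! ### Slices -/

/-! Property `(α)` excludes Daugavet-points. Given a unit vector `z` of `X ⊕_N Y`, it keeps one
component of every point of the ball nearly at distance 2 from `z` uniformly below norm 1. A slice
cut by a norm-one functional on that component contains no such point
(`AbsNorm.PropertyAlpha.not_isDaugavetPoint`).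

For the relative property, write `z = (a x, b y)` with `x`, `y` unit vectors and support `N` at `(a,
b)` by `(p, q)` with `p, q ≥ 0`. The functional at `z` is `(p f₁, q f₂)`, where `f₁`, `f₂` witness
the property at `x`, `y`. Polyhedrality leaves only finitely many pairs `(c, d)` at which the norms
of the components of an arbitrary functional need be tested, so one width `α` undercuts all relevant
positive gaps. If a slice by `(g₁, g₂)` lies in the `α`-slice, its maximizer `(c, d)` must satisfy
`p c + q d = 1`, and the thin slices by `g₁` and `g₂` lie in those of `f₁` and `f₂` wherever the
weights `p c`, `q d` are positive. This gives `u`, `v` nearly antipodal to `x`, `y`, and `(p, q)`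
shows that `(c u, d v)` has distance nearly `p (a + c) + q (b + d) = 2` from `z`
(`RelativeDaugavetProperty.absSum`).

The concrete example uses bounded continuous functions on the line and a twelve-sided unit ball. -/

theorem isLUB_norm_sub_slice_iff {X : Type*} [NormedAddCommGroup X] [NormedSpace ℝ X] {x : X}
    (hx : ‖x‖ = 1) (g : StrongDual ℝ X) (β : ℝ) :
    IsLUB ((fun y => ‖x - y‖) '' slice g β) 2 ↔
      ∀ δ : ℝ, 0 < δ → ∃ y ∈ slice g β, 2 - δ < ‖x - y‖ := by
  constructor
  · intro h δ hδ
    obtain ⟨_, ⟨y, hy, rfl⟩, h1, -⟩ := h.exists_between (sub_lt_self 2 hδ)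
    exact ⟨y, hy, h1⟩
  · intro h
    refine ⟨?_, fun b hb => le_of_forall_pos_lt_add fun δ hδ => ?_⟩
    · rintro _ ⟨y, hy, rfl⟩
      have h1 := norm_sub_le x y
      have h2 := hy.1
      simp only
      linarith
    · obtain ⟨y, hy, h1⟩ := h δ hδ
      have h2 : ‖x - y‖ ≤ b := hb ⟨y, hy, rfl⟩
      linarith

theorem slice_nonempty {X : Type*} [NormedAddCommGroup X] [NormedSpace ℝ X]
    (g : StrongDual ℝ X) {β : ℝ} (hβ : 0 < β) : (slice g β).Nonempty := by
  obtain ⟨_, ⟨y, hy, rfl⟩, h1, -⟩ := (isLUB_image_closedBall g).exists_between (sub_lt_self _ hβ)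
  exact ⟨y, mem_closedBall_zero_iff.1 hy, h1⟩

/-- The Daugavet property implies the relative Daugavet property. -/
theorem DaugavetProperty.relativeDaugavetProperty {X : Type*} [NormedAddCommGroup X]
    [NormedSpace ℝ X] (h : DaugavetProperty X) : RelativeDaugavetProperty X := by
  intro x hx
  obtain ⟨f, hf, hfx⟩ := exists_dual_vector ℝ x (by rw [hx]; exact one_ne_zero)
  -- The width 1 is arbitrary: the distance condition holds for all slices.
  refine ⟨hx, f, 1, hf, ?_, one_pos, fun g β hβ _ => (h x hx).2 g β hβ⟩
  rw [hfx, hx]; rfl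

/-! ### A space with the Daugavet property -/

/-- Any real interval carries any finite number of bumps which attain the value `1` and add up to
at most `1`. -/
theorem exists_bumps (n : ℕ) (t₀ : ℝ) {δ : ℝ} (hδ : 0 < δ) :
    ∃ φ : ℕ → ℝ → ℝ, (∀ i, Continuous (φ i)) ∧ (∀ i t, 0 ≤ φ i t) ∧ (∀ i t, φ i t ≤ 1) ∧
      (∀ t, ∑ i ∈ Finset.range n, φ i t ≤ 1) ∧
      ∀ i ∈ Finset.range n, ∃ t, |t - t₀| < δ ∧ φ i t = 1 := by
  -- Tents of radius `r` centred at `t₀ + 2 i r` do not overlap, and all centres stay within `2 n r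
  -- < δ` of `t₀`.
  set r : ℝ := δ / (2 * n + 1) with hr
  have hr0 : 0 < r := by positivity
  have hle : ∀ (i : ℕ) (t : ℝ), max 0 (1 - |(t - t₀) / r - 2 * i|) ≤ 1 := fun i t =>
    max_le zero_le_one (by linarith [abs_nonneg ((t - t₀) / r - 2 * i)])
  refine ⟨fun i t => max 0 (1 - |(t - t₀) / r - 2 * i|), fun i => by fun_prop,
    fun i t => le_max_left _ _, hle, fun t => ?_, fun i hi => ⟨t₀ + 2 * i * r, ?_, ?_⟩⟩
  · by_cases h : ∃ j ∈ Finset.range n, |(t - t₀) / r - 2 * j| < 1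
    · obtain ⟨j, hj, hj1⟩ := h
      rw [Finset.sum_eq_single_of_mem j hj]
      · exact hle j t
      · intro i _ hij
        refine max_eq_left ?_
        by_contra! hi1
        have h1 := abs_lt.1 hj1
        have h2 := abs_lt.1 (show |(t - t₀) / r - 2 * i| < 1 by linarith)
        have h3 : (i : ℝ) < j + 1 := by linarith
        have h4 : (j : ℝ) < i + 1 := by linarith
        norm_cast at h3 h4
        omega
    · push Not at h
      rw [Finset.sum_eq_zero fun i hi => max_eq_left (by linarith [h i hi])]
      exact zero_le_one
  · have hi' : (i : ℝ) ≤ n := by exact_mod_cast (Finset.mem_range.1 hi).le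
    have h1 : r * (2 * n + 1) = δ := by rw [hr]; field_simp
    rw [add_sub_cancel_left, abs_of_nonneg (by positivity)]
    nlinarith
  · have : (t₀ + 2 * i * r - t₀) / r - 2 * i = 0 := by field_simp; ring
    simp only [this]
    norm_num

/-- The space of bounded continuous functions on the line has the Daugavet property. -/
theorem daugavetProperty_boundedContinuousFunction :
    DaugavetProperty (BoundedContinuousFunction ℝ ℝ) := by
  intro f hf
  refine ⟨hf, fun g β hβ => (isLUB_norm_sub_slice_iff hf g β).2 fun δ hδ => ?_⟩
  obtain ⟨t₀, ht₀⟩ : ∃ t, 1 - δ / 2 < |f t| := by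
    by_contra! h
    have h1 : ‖f‖ ≤ max 0 (1 - δ / 2) :=
      (BoundedContinuousFunction.norm_le (le_max_left _ _)).2 fun t => le_max_of_le_right (h t)
    rw [hf, le_max_iff] at h1
    rcases h1 with h1 | h1 <;> linarith
  obtain ⟨s, hs, hst⟩ : ∃ s : ℝ, |s| = 1 ∧ s * f t₀ = |f t₀| := by
    rcases le_total 0 (f t₀) with h | h
    · exact ⟨1, by simp, by rw [abs_of_nonneg h, one_mul]⟩
    · exact ⟨-1, by simp, by rw [abs_of_nonpos h, neg_one_mul]⟩
  obtain ⟨η, hη, hηf⟩ := Metric.continuousAt_iff.1 (f.continuous.continuousAt (x := t₀)) (δ / 2)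
    (half_pos hδ)
  obtain ⟨y, hy, hgy⟩ := slice_nonempty g (half_pos hβ)
  -- With this many bumps, a loss of at least `β / 2` under `g` on each would exceed the total `2
  -- ‖g‖` allowed by their sum.
  obtain ⟨n, hn⟩ := exists_nat_gt (2 * ‖g‖ / (β / 2))
  obtain ⟨φ, hφc, hφ0, hφ1, hφs, hφp⟩ := exists_bumps n t₀ hη
  have hyt : ∀ t, |y t| ≤ 1 := fun t => (y.norm_coe_le_norm t).trans hy
  let ψ : ℕ → BoundedContinuousFunction ℝ ℝ := fun i =>
    .ofNormedAddCommGroup (φ i) (hφc i) 1 fun t => by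
      rw [Real.norm_of_nonneg (hφ0 i t)]; exact hφ1 i t
  let c : BoundedContinuousFunction ℝ ℝ := .const ℝ (-s)
  have hct : ∀ t, |c t| = 1 := fun t => by simp [c, hs]
  obtain ⟨i, hi, hgi⟩ : ∃ i ∈ Finset.range n, -(β / 2) < g (ψ i * (c - y)) := by
    by_contra! h
    have h1 : g (∑ i ∈ Finset.range n, ψ i * (c - y)) ≤ n * -(β / 2) := by
      rw [map_sum]
      simpa using Finset.sum_le_sum h
    have h2 : ‖∑ i ∈ Finset.range n, ψ i * (c - y)‖ ≤ 2 := by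
      refine (BoundedContinuousFunction.norm_le zero_le_two).2 fun t => ?_
      rw [← Finset.sum_mul, BoundedContinuousFunction.mul_apply, norm_mul,
        BoundedContinuousFunction.sum_apply]
      have h3 : ‖∑ i ∈ Finset.range n, ψ i t‖ ≤ 1 := by
        change ‖∑ i ∈ Finset.range n, φ i t‖ ≤ 1
        rw [Real.norm_of_nonneg (Finset.sum_nonneg fun i _ => hφ0 i t)]
        exact hφs t
      have h4 : ‖(c - y) t‖ ≤ 2 := by
        have h5 : ‖c t - y t‖ ≤ |c t| + |y t| := norm_sub_le _ _
        rw [hct] at h5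
        exact h5.trans (by linarith [hyt t])
      nlinarith [norm_nonneg ((c - y) t)]
    have h3 : ‖g (∑ i ∈ Finset.range n, ψ i * (c - y))‖ ≤ ‖g‖ * 2 :=
      (g.le_opNorm _).trans (mul_le_mul_of_nonneg_left h2 (norm_nonneg _))
    rw [div_lt_iff₀ (half_pos hβ)] at hn
    rw [Real.norm_eq_abs] at h3
    linarith [neg_abs_le (g (∑ i ∈ Finset.range n, ψ i * (c - y)))]
  obtain ⟨t, ht, hφt⟩ := hφp i hi
  -- Pointwise a convex combination of `y` and `-s`: it stays in the ball, and equals `-s` at the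
  -- peak of the bump, where `f` is almost `s`.
  refine ⟨y + ψ i * (c - y), ⟨?_, ?_⟩, ?_⟩
  · refine (BoundedContinuousFunction.norm_le zero_le_one).2 fun t => ?_
    have h0 := hφ0 i t
    have h1 := hφ1 i t
    have h2 := abs_le.1 (hyt t)
    have h3 := abs_le.1 (hct t).le
    change |y t + φ i t * (c t - y t)| ≤ 1
    rw [abs_le]
    constructor <;> nlinarith
  · rw [map_add]; linarith
  · refine lt_of_lt_of_le ?_ ((f - (y + ψ i * (c - y))).norm_coe_le_norm t)
    change 2 - δ < |f t - (y t + φ i t * (-s - y t))|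
    rw [hφt]
    have h1 : |f t - f t₀| < δ / 2 := hηf ht
    have h2 : |s * (f t - f t₀)| < δ / 2 := by rwa [abs_mul, hs, one_mul]
    have h3 := (abs_lt.1 h2).1
    have h4 : |f t - (y t + 1 * (-s - y t))| = |s * (f t + s)| := by
      rw [abs_mul, hs, one_mul, one_mul,
        show f t - (y t + (-s - y t)) = f t + s by ring]
    have h5 : s * s = 1 := by rw [← abs_mul_abs_self, hs, one_mul]
    rw [h4]
    refine lt_of_lt_of_le ?_ (le_abs_self _)
    nlinarith

/-! ### A polyhedral norm with property `(α)` -/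

/-- The absolute norm `max (|a| + |b|/2) (|a|/2 + |b|) (4/5 (|a| + |b|))`. -/
noncomputable def AbsNorm.dodecagonal : AbsNorm where
  toFun p := max (max (|p.1| + |p.2| / 2) (|p.1| / 2 + |p.2|)) (4 / 5 * (|p.1| + |p.2|))
  map_zero' := by simp
  add_le' p q := by
    have h1 := abs_add_le p.1 q.1
    have h2 := abs_add_le p.2 q.2
    simp only [Prod.fst_add, Prod.snd_add]
    refine max_le (max_le ?_ ?_) ?_
    · refine le_trans ?_ (add_le_add ((le_max_left _ _).trans (le_max_left _ _))
        ((le_max_left _ _).trans (le_max_left _ _)))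
      linarith
    · refine le_trans ?_ (add_le_add ((le_max_right _ _).trans (le_max_left _ _))
        ((le_max_right _ _).trans (le_max_left _ _)))
      linarith
    · refine le_trans ?_ (add_le_add (le_max_right _ _) (le_max_right _ _))
      linarith
  neg' p := by simp
  smul' c p := by
    simp only [Prod.smul_fst, Prod.smul_snd, smul_eq_mul, abs_mul, Real.norm_eq_abs]
    rw [mul_max_of_nonneg _ _ (abs_nonneg c), mul_max_of_nonneg _ _ (abs_nonneg c)]
    congr 1
    · congr 1 <;> ring
    · ring
  eq_zero' p hp := by
    have h1 := (le_max_left _ _).trans ((le_max_left _ _).trans_eq hp)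
    have h2 := abs_nonneg p.1
    have h3 := abs_nonneg p.2
    exact Prod.ext (abs_eq_zero.1 (by linarith)) (abs_eq_zero.1 (by linarith))
  absolute' a b := by simp
  normalized_fst' := by norm_num
  normalized_snd' := by norm_num

namespace AbsNorm

theorem dodecagonal_le_iff {a b r : ℝ} : dodecagonal (a, b) ≤ r ↔
    (|a| + |b| / 2 ≤ r ∧ |a| / 2 + |b| ≤ r) ∧ 4 / 5 * (|a| + |b|) ≤ r := by
  change max (max _ _) _ ≤ r ↔ _
  rw [max_le_iff, max_le_iff]

theorem dodecagonal_isPolyhedral : dodecagonal.IsPolyhedral := by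
  classical
  let S : Finset (ℝ × ℝ) := {(1, 1 / 2), (1 / 2, 1), (4 / 5, 4 / 5)}
  let T : Finset (ℝ × ℝ) := {(1, 1), (1, -1), (-1, 1), (-1, -1)}
  let φ : (ℝ × ℝ) × (ℝ × ℝ) → StrongDual ℝ (ℝ × ℝ) := fun w =>
    (w.1.1 * w.2.1) • ContinuousLinearMap.fst ℝ ℝ ℝ +
      (w.1.2 * w.2.2) • ContinuousLinearMap.snd ℝ ℝ ℝ
  have hφ : ∀ w p, φ w p = w.1.1 * w.2.1 * p.1 + w.1.2 * w.2.2 * p.2 := fun w p => rfl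
  refine ⟨(S ×ˢ T).image fun w => (φ w, 1), fun h hh h0 => ?_, ?_⟩
  · obtain ⟨w, hw, rfl⟩ := Finset.mem_image.1 hh
    have h1 : φ w (1, 0) = 0 := by rw [show φ w = 0 from h0]; rfl
    rw [hφ] at h1
    simp only [S, T, Finset.mem_product, Finset.mem_insert, Finset.mem_singleton] at hw
    obtain ⟨h2 | h2 | h2, h3 | h3 | h3 | h3⟩ := hw <;> rw [h2, h3] at h1 <;> norm_num at h1
  · ext ⟨a, b⟩
    have key : ∀ {x y : ℝ}, 0 ≤ x → 0 ≤ y → (x * |a| + y * |b| ≤ 1 ↔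
        ∀ t ∈ T, x * t.1 * a + y * t.2 * b ≤ 1) := by
      intro x y hx hy
      simp only [T, Finset.forall_mem_insert, Finset.mem_singleton, forall_eq]
      have h1 := mul_le_mul_of_nonneg_left (le_abs_self a) hx
      have h2 := mul_le_mul_of_nonneg_left (neg_le_abs a) hx
      have h3 := mul_le_mul_of_nonneg_left (le_abs_self b) hy
      have h4 := mul_le_mul_of_nonneg_left (neg_le_abs b) hy
      refine ⟨fun h => ⟨?_, ?_, ?_, ?_⟩, fun h => ?_⟩
      · linarith
      · linarith
      · linarith
      · linarith
      · rcases abs_cases a with ⟨ha, -⟩ | ⟨ha, -⟩ <;> rcases abs_cases b with ⟨hb, -⟩ | ⟨hb, -⟩ <;>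
          rw [ha, hb] <;> linarith
    have hS : (a, b) ∈ (⋂ h ∈ (S ×ˢ T).image fun w => (φ w, (1 : ℝ)), {p : ℝ × ℝ | h.1 p ≤ h.2}) ↔
        ∀ s ∈ S, ∀ t ∈ T, s.1 * t.1 * a + s.2 * t.2 * b ≤ 1 := by
      simp only [Set.mem_iInter, Finset.forall_mem_image, Set.mem_ofPred_eq, hφ,
        Finset.mem_product]
      exact ⟨fun h s hs t ht => h (x := (s, t)) ⟨hs, ht⟩, fun h w hw => h _ hw.1 _ hw.2⟩
    rw [hS, Set.mem_ofPred_eq, dodecagonal_le_iff]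
    simp only [S, Finset.forall_mem_insert, Finset.mem_singleton, forall_eq]
    rw [← key (by norm_num) (by norm_num), ← key (by norm_num) (by norm_num),
      ← key (by norm_num) (by norm_num), and_assoc]
    refine and_congr ?_ (and_congr ?_ ?_) <;> constructor <;> intro h <;> linarith

/-- The smaller coordinate of `(a, b)` is the one bounded away from 1. The form `4/5 (|a| + |b|)` is
essential: it cuts off the corner `(2/3, 2/3)` of the first two forms, which would be at sum-norm 2
with both `(1, 0)` and `(0, 1)`. -/
theorem dodecagonal_propertyAlpha : dodecagonal.PropertyAlpha := by
  -- The second form is the tight one: `b ≤ a` and `a + b ≤ 5/4` give `a/2 + b ≤ 15/16`. Hence `ε =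
  -- 1/32` below is small enough for a strict contradiction.
  have key : ∀ {a b c d : ℝ}, 0 ≤ a → 0 ≤ b → 0 ≤ c → 0 ≤ d →
      a + b / 2 ≤ 1 → 4 / 5 * (a + b) ≤ 1 → c / 2 + d ≤ 1 → b ≤ a → 7 / 8 ≤ d →
      (a + c + (b + d) / 2 ≤ 31 / 16 ∧ (a + c) / 2 + (b + d) ≤ 31 / 16) ∧
        4 / 5 * (a + c + (b + d)) ≤ 31 / 16 := by
    intro a b c d _ _ _ _ _ _ _ _ _
    refine ⟨⟨?_, ?_⟩, ?_⟩ <;> linarith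
  intro a b ha hb hab
  have hab' := dodecagonal_le_iff.1 hab.le
  rw [abs_of_nonneg ha, abs_of_nonneg hb] at hab'
  rcases le_total b a with h | h
  · refine ⟨1 / 32, by norm_num, {p | p.2 < 7 / 8},
      (isOpen_lt continuous_snd continuous_const).mem_nhds (show b < 7 / 8 by linarith),
      Or.inr ⟨7 / 8, by norm_num, fun p hp => hp.le⟩, fun c d hc hd hcd hs => ?_⟩
    by_contra hd'
    have hcd' := dodecagonal_le_iff.1 hcd.le
    rw [abs_of_nonneg hc, abs_of_nonneg hd] at hcd'
    have h1 := key ha hb hc hd hab'.1.1 hab'.2 hcd'.1.2 h (not_lt.1 hd')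
    have h2 : dodecagonal (a + c, b + d) ≤ 31 / 16 := by
      rw [dodecagonal_le_iff, abs_of_nonneg (by positivity), abs_of_nonneg (by positivity)]
      exact h1
    linarith
  · refine ⟨1 / 32, by norm_num, {p | p.1 < 7 / 8},
      (isOpen_lt continuous_fst continuous_const).mem_nhds (show a < 7 / 8 by linarith),
      Or.inl ⟨7 / 8, by norm_num, fun p hp => hp.le⟩, fun c d hc hd hcd hs => ?_⟩
    by_contra hd'
    have hcd' := dodecagonal_le_iff.1 hcd.le
    rw [abs_of_nonneg hc, abs_of_nonneg hd] at hcd'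
    have h1 := key hb ha hd hc (by linarith) (by linarith) (by linarith) h (not_lt.1 hd')
    have h2 : dodecagonal (a + c, b + d) ≤ 31 / 16 := by
      rw [dodecagonal_le_iff, abs_of_nonneg (by positivity), abs_of_nonneg (by positivity)]
      exact ⟨⟨by linarith, by linarith⟩, by linarith⟩
    linarith

end AbsNorm

/-! ### Geometry of absolute norms -/

namespace AbsNorm

variable (N : AbsNorm)

theorem absolute (a b : ℝ) : N (|a|, |b|) = N (a, b) := (N.absolute' a b).symm

theorem mono {a b c d : ℝ} (ha : 0 ≤ a) (hac : a ≤ c) (hb : 0 ≤ b) (hbd : b ≤ d) :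
    N (a, b) ≤ N (c, d) :=
  (N.mono_fst b ha hac).trans (N.mono_snd c hb hbd)

theorem smul_apply {t : ℝ} (ht : 0 ≤ t) (p : ℝ × ℝ) : N (t • p) = t * N p := by
  have := map_smul_eq_mul N.toSeminorm t p
  rwa [Real.norm_of_nonneg ht] at this

theorem apply_fst {a : ℝ} (ha : 0 ≤ a) : N (a, 0) = a := by
  have := N.smul_apply ha (1, 0)
  rw [show N (1, 0) = 1 from N.normalized_fst'] at this
  simpa using this

theorem apply_snd {b : ℝ} (hb : 0 ≤ b) : N (0, b) = b := by
  have := N.smul_apply hb (0, 1)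
  rw [show N (0, 1) = 1 from N.normalized_snd'] at this
  simpa using this

theorem abs_fst_le (p : ℝ × ℝ) : |p.1| ≤ N p := by
  calc |p.1| = N (|p.1|, 0) := (N.apply_fst (abs_nonneg _)).symm
    _ ≤ N (|p.1|, |p.2|) := N.mono_snd _ le_rfl (abs_nonneg _)
    _ = N p := N.absolute _ _

theorem abs_snd_le (p : ℝ × ℝ) : |p.2| ≤ N p := by
  calc |p.2| = N (0, |p.2|) := (N.apply_snd (abs_nonneg _)).symm
    _ ≤ N (|p.1|, |p.2|) := N.mono_fst _ le_rfl (abs_nonneg _)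
    _ = N p := N.absolute _ _

theorem le_add (a b : ℝ) (ha : 0 ≤ a) (hb : 0 ≤ b) : N (a, b) ≤ a + b := by
  have h := map_add_le_add N.toSeminorm (a, 0) (0, b)
  have h1 : N (a, 0) = a := N.apply_fst ha
  have h2 : N (0, b) = b := N.apply_snd hb
  have h3 : ((a, 0) + (0, b) : ℝ × ℝ) = (a, b) := by simp
  rw [h3] at h
  linarith

end AbsNorm

/-! ### Functionals on absolute sums -/

namespace AbsSum

/-- The pair `(x, y)` as an element of the absolute sum. -/
def mk (N : AbsNorm) {X Y : Type*} (x : X) (y : Y) : AbsSum N X Y := (x, y)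

variable {N : AbsNorm} {X Y : Type*} [NormedAddCommGroup X] [NormedSpace ℝ X]
  [NormedAddCommGroup Y] [NormedSpace ℝ Y]

set_option linter.unusedSectionVars false in
theorem norm_mk (x : X) (y : Y) : ‖mk N x y‖ = N (‖x‖, ‖y‖) := rfl

set_option linter.unusedSectionVars false in
theorem norm_fst_le (z : AbsSum N X Y) : ‖z.1‖ ≤ ‖z‖ := by
  have := N.abs_fst_le (‖z.1‖, ‖z.2‖)
  rwa [abs_norm] at this

set_option linter.unusedSectionVars false in
theorem norm_snd_le (z : AbsSum N X Y) : ‖z.2‖ ≤ ‖z‖ := by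
  have := N.abs_snd_le (‖z.1‖, ‖z.2‖)
  rwa [abs_norm] at this

/-- The identity map, as an isomorphism from the absolute sum to the product. -/
noncomputable def toProd (N : AbsNorm) (X Y : Type*) [NormedAddCommGroup X] [NormedSpace ℝ X]
    [NormedAddCommGroup Y] [NormedSpace ℝ Y] : AbsSum N X Y ≃L[ℝ] X × Y :=
  ContinuousLinearEquiv.equivOfInverse
    (LinearMap.mkContinuous (⟨⟨fun z => (z.1, z.2), fun _ _ => rfl⟩, fun _ _ => rfl⟩ :
      AbsSum N X Y →ₗ[ℝ] X × Y) 1 fun z => by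
        rw [one_mul]; exact max_le (norm_fst_le z) (norm_snd_le z))
    (LinearMap.mkContinuous (⟨⟨fun z => mk N z.1 z.2, fun _ _ => rfl⟩, fun _ _ => rfl⟩ :
      X × Y →ₗ[ℝ] AbsSum N X Y) 2 fun z => by
        have h1 : ‖mk N z.1 z.2‖ ≤ ‖z.1‖ + ‖z.2‖ :=
          N.le_add _ _ (norm_nonneg _) (norm_nonneg _)
        have h2 : ‖z.1‖ ≤ ‖z‖ := _root_.norm_fst_le z
        have h3 : ‖z.2‖ ≤ ‖z‖ := _root_.norm_snd_le z
        change ‖mk N z.1 z.2‖ ≤ 2 * ‖z‖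
        linarith)
    (fun _ => rfl) (fun _ => rfl)

instance [CompleteSpace X] [CompleteSpace Y] : CompleteSpace (AbsSum N X Y) :=
  (completeSpace_congr (e := (toProd N X Y).toEquiv)
    (toProd N X Y).isUniformEmbedding).2 inferInstance

/-- The functional `(x, y) ↦ f x + g y`. -/
noncomputable def coprod (N : AbsNorm) (f : StrongDual ℝ X) (g : StrongDual ℝ Y) :
    StrongDual ℝ (AbsSum N X Y) :=
  (f.coprod g).comp (toProd N X Y : AbsSum N X Y →L[ℝ] X × Y)

theorem coprod_apply (f : StrongDual ℝ X) (g : StrongDual ℝ Y) (z : AbsSum N X Y) :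
    coprod N f g z = f z.1 + g z.2 := rfl

theorem exists_eq_coprod (h : StrongDual ℝ (AbsSum N X Y)) :
    ∃ (f : StrongDual ℝ X) (g : StrongDual ℝ Y), h = coprod N f g := by
  let k : StrongDual ℝ (X × Y) := h.comp ((toProd N X Y).symm : X × Y →L[ℝ] AbsSum N X Y)
  refine ⟨k.comp (ContinuousLinearMap.inl ℝ X Y), k.comp (ContinuousLinearMap.inr ℝ X Y),
    ContinuousLinearMap.ext fun z => ?_⟩
  have h1 : k (z.1, z.2) = k (z.1, 0) + k (0, z.2) := by
    rw [← map_add, Prod.mk_add_mk, add_zero, zero_add]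
  exact h1

end AbsSum

/-! ### Supporting functionals and polyhedral norms -/

/-- Every point of the quadrant has a supporting functional with nonnegative coefficients. -/
theorem AbsNorm.exists_support (N : AbsNorm) {a b : ℝ} (ha : 0 ≤ a) (hb : 0 ≤ b)
    (hab : N (a, b) = 1) :
    ∃ p q : ℝ, 0 ≤ p ∧ 0 ≤ q ∧ p * a + q * b = 1 ∧
      ∀ c d : ℝ, 0 ≤ c → 0 ≤ d → p * c + q * d ≤ N (c, d) := by
  -- The plane normed by `N` is the absolute sum of two copies of `ℝ`, so Hahn–Banach applies there.
  have hn : ∀ c d : ℝ, ‖AbsSum.mk N c d‖ = N (c, d) := fun c d => N.absolute c d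
  obtain ⟨f, hf, hfz⟩ := exists_dual_vector'' ℝ (AbsSum.mk N a b)
  have hfv : ∀ c d : ℝ, f (AbsSum.mk N c d) =
      f (AbsSum.mk N 1 0) * c + f (AbsSum.mk N 0 1) * d := by
    intro c d
    have : AbsSum.mk N c d =
        c • (AbsSum.mk N 1 0) + d • (AbsSum.mk N 0 1) := by
      refine Prod.ext ?_ ?_
      · change c = c * 1 + d * 0; ring
      · change d = c * 0 + d * 1; ring
    rw [this, map_add, map_smul, map_smul, smul_eq_mul, smul_eq_mul]; ring
  set p := f (AbsSum.mk N 1 0)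
  set q := f (AbsSum.mk N 0 1)
  -- Sign changes of `c` and `d` preserve `N`, so the coefficients may be replaced by their absolute
  -- values.
  have hle : ∀ c d : ℝ, 0 ≤ c → 0 ≤ d → |p| * c + |q| * d ≤ N (c, d) := by
    intro c d hc hd
    obtain ⟨s, hs, hsp⟩ : ∃ s : ℝ, |s| = 1 ∧ p * s = |p| := by
      rcases abs_cases p with ⟨h, -⟩ | ⟨h, -⟩
      · exact ⟨1, by simp, by rw [h]; ring⟩
      · exact ⟨-1, by simp, by rw [h]; ring⟩
    obtain ⟨t, ht, htq⟩ : ∃ t : ℝ, |t| = 1 ∧ q * t = |q| := by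
      rcases abs_cases q with ⟨h, -⟩ | ⟨h, -⟩
      · exact ⟨1, by simp, by rw [h]; ring⟩
      · exact ⟨-1, by simp, by rw [h]; ring⟩
    have h1 : |f (AbsSum.mk N (s * c) (t * d))| ≤ 1 * N (s * c, t * d) :=
      (f.le_of_opNorm_le hf _).trans_eq (by rw [hn])
    rw [hfv, one_mul, ← N.absolute, abs_mul, abs_mul, hs, ht, one_mul, one_mul, N.absolute] at h1
    calc |p| * c + |q| * d = p * (s * c) + q * (t * d) := by rw [← hsp, ← htq]; ring
      _ ≤ _ := (le_abs_self _).trans h1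
  refine ⟨|p|, |q|, abs_nonneg _, abs_nonneg _, le_antisymm (hab ▸ hle a b ha hb) ?_, hle⟩
  have h1 : p * a + q * b = 1 := by
    rw [← hfv, hfz, hn, hab]; rfl
  have h2 := mul_le_mul_of_nonneg_right (le_abs_self p) ha
  have h3 := mul_le_mul_of_nonneg_right (le_abs_self q) hb
  linarith

/-- A finite intersection of closed half-spaces has finitely many extreme points. -/
theorem finite_extremePoints_of_halfspaces {E : Type*} [AddCommGroup E] [Module ℝ E]
    [TopologicalSpace E] (H : Finset (StrongDual ℝ E × ℝ)) :
    (Set.extremePoints ℝ (⋂ h ∈ H, {p : E | h.1 p ≤ h.2})).Finite := by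
  classical
  set K : Set E := ⋂ h ∈ H, {p : E | h.1 p ≤ h.2} with hK
  have memK : ∀ p, p ∈ K ↔ ∀ h ∈ H, h.1 p ≤ h.2 := fun p => by simp [hK]
  -- Active constraints determine an extreme point: if `e` and `e'` share them, these are constant
  -- along `e' - e` and the others have slack at `e`, so `e` can move both ways inside `K`.
  let A : E → Finset (StrongDual ℝ E × ℝ) := fun e => H.filter fun h => h.1 e = h.2
  refine Set.Finite.of_finite_image (f := A)
    ((Finset.finite_toSet H.powerset).subset ?_) fun e he e' he' hee' => ?_
  · rintro _ ⟨e, -, rfl⟩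
    exact Finset.mem_coe.2 (Finset.mem_powerset.2 (Finset.filter_subset _ _))
  · have hd : ∀ h ∈ H, h.1 e = h.2 → h.1 (e' - e) = 0 := by
      intro h hh h1
      have h2 : h ∈ A e' := hee' ▸ Finset.mem_filter.2 ⟨hh, h1⟩
      rw [map_sub, (Finset.mem_filter.1 h2).2, h1, sub_self]
    obtain ⟨t, ht, htH⟩ : ∃ t : ℝ, 0 < t ∧ ∀ h ∈ H, t * |h.1 (e' - e)| ≤ h.2 - h.1 e := by
      have hev : ∀ᶠ t : ℝ in 𝓝[>] 0, ∀ h ∈ H, t * |h.1 (e' - e)| ≤ h.2 - h.1 e := by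
        rw [Finset.eventually_all]
        intro h hh
        rcases ((memK e).1 he.1 h hh).eq_or_lt with h1 | h1
        · refine Filter.Eventually.of_forall fun t => ?_
          rw [hd h hh h1, abs_zero, mul_zero, h1, sub_self]
        · have h2 : Filter.Tendsto (fun t : ℝ => t * |h.1 (e' - e)|) (𝓝[>] 0) (𝓝 0) := by
            have : Continuous fun t : ℝ => t * |h.1 (e' - e)| := by fun_prop
            exact (this.tendsto' 0 0 (zero_mul _)).mono_left nhdsWithin_le_nhds
          exact (h2.eventually_lt_const (sub_pos.2 h1)).mono fun t ht => ht.le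
      obtain ⟨t, h1, h2⟩ := (hev.and self_mem_nhdsWithin).exists
      exact ⟨t, h2, h1⟩
    have hmem : ∀ s : ℝ, |s| = t → e + s • (e' - e) ∈ K := by
      intro s hs
      refine (memK _).2 fun h hh => ?_
      have h1 := htH h hh
      rw [← hs, ← abs_mul] at h1
      rw [map_add, map_smul, smul_eq_mul]
      linarith [le_abs_self (s * h.1 (e' - e))]
    have h1 := mem_extremePoints.1 he
    have h2 := (h1.2 _ (hmem t (abs_of_pos ht)) _ (hmem (-t) (by rw [abs_neg, abs_of_pos ht]))
      ⟨1 / 2, 1 / 2, by norm_num, by norm_num, by norm_num, by module⟩).1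
    have h3 : t • (e' - e) = 0 := by simpa using h2
    exact (sub_eq_zero.1 ((smul_eq_zero.1 h3).resolve_left ht.ne')).symm

/-- A continuous linear functional attains its maximum over a nonempty compact set at an extreme
point. -/
theorem IsCompact.exists_extremePoint_isMaxOn {E : Type*} [AddCommGroup E] [Module ℝ E]
    [TopologicalSpace E] [T2Space E] [IsTopologicalAddGroup E] [ContinuousSMul ℝ E]
    [LocallyConvexSpace ℝ E] {K : Set E} (hK : IsCompact K) (hne : K.Nonempty)
    (f : StrongDual ℝ E) : ∃ e ∈ K.extremePoints ℝ, ∀ y ∈ K, f y ≤ f e := by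
  obtain ⟨x, hx, hmax⟩ := hK.exists_isMaxOn hne f.continuous.continuousOn
  -- The maximizers form a compact exposed face; its extreme points, supplied by Krein–Milman, are
  -- extreme in `K`.
  have hexp : IsExposed ℝ K {x ∈ K | ∀ y ∈ K, f y ≤ f x} := fun _ => ⟨f, rfl⟩
  obtain ⟨e, he⟩ := (hexp.isCompact hK).extremePoints_nonempty ⟨x, hx, hmax⟩
  exact ⟨e, hexp.isExtreme.extremePoints_subset_extremePoints he, he.1.2⟩

/-- For a polyhedral norm, all functionals with nonnegative coefficients attain their maxima over
the unit ball on one finite subset of the quadrant. -/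
theorem AbsNorm.IsPolyhedral.exists_finset_maximizers {N : AbsNorm} (hN : N.IsPolyhedral) :
    ∃ V : Finset (ℝ × ℝ), (∀ w ∈ V, 0 ≤ w.1 ∧ 0 ≤ w.2 ∧ N w ≤ 1) ∧
      ∀ p q : ℝ, 0 ≤ p → 0 ≤ q → ∃ w ∈ V, ∀ c d : ℝ, N (c, d) ≤ 1 →
        p * c + q * d ≤ p * w.1 + q * w.2 := by
  classical
  obtain ⟨H, -, hH⟩ := hN
  have hfin := finite_extremePoints_of_halfspaces H
  rw [← hH] at hfin
  have hcl : IsClosed {p : ℝ × ℝ | N p ≤ 1} := by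
    rw [hH]
    exact isClosed_biInter fun h _ => isClosed_le h.1.continuous continuous_const
  have hcpt : IsCompact {p : ℝ × ℝ | N p ≤ 1} := by
    refine (isCompact_closedBall (0 : ℝ × ℝ) 1).of_isClosed_subset hcl fun p hp => ?_
    rw [mem_closedBall_zero_iff, Prod.norm_def]
    exact max_le ((N.abs_fst_le p).trans hp) ((N.abs_snd_le p).trans hp)
  have hne : {p : ℝ × ℝ | N p ≤ 1}.Nonempty := ⟨(1, 0), N.normalized_fst'.le⟩
  -- Passing to absolute values keeps `N` and can only increase a functional with nonnegative
  -- coefficients.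
  refine ⟨hfin.toFinset.image fun w => (|w.1|, |w.2|), fun w hw => ?_, fun p q hp hq => ?_⟩
  · obtain ⟨e, he, rfl⟩ := Finset.mem_image.1 hw
    refine ⟨abs_nonneg _, abs_nonneg _, ?_⟩
    rw [N.absolute]
    exact ((Set.Finite.mem_toFinset _).1 he).1
  · obtain ⟨e, he, hmax⟩ := hcpt.exists_extremePoint_isMaxOn hne
      (p • ContinuousLinearMap.fst ℝ ℝ ℝ + q • ContinuousLinearMap.snd ℝ ℝ ℝ)
    refine ⟨_, Finset.mem_image_of_mem _ ((Set.Finite.mem_toFinset _).2 he), fun c d hcd => ?_⟩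
    have h1 : p * c + q * d ≤ p * e.1 + q * e.2 := hmax (c, d) hcd
    have h2 := mul_le_mul_of_nonneg_left (le_abs_self e.1) hp
    have h3 := mul_le_mul_of_nonneg_left (le_abs_self e.2) hq
    linarith

/-- Supplies the slice width below finitely many positive gaps; vanishing gaps impose no condition.
-/
theorem Finset.exists_pos_le_of_pos (F : Finset ℝ) :
    ∃ α : ℝ, 0 < α ∧ ∀ r ∈ F, 0 < r → α ≤ r := by
  induction F using Finset.induction_on with
  | empty => exact ⟨1, one_pos, by simp⟩
  | insert r F _ ih =>
    obtain ⟨α, hα, h⟩ := ih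
    rcases le_or_gt r 0 with hr | hr
    · exact ⟨α, hα, fun s hs hs0 => (Finset.mem_insert.1 hs).elim
        (fun e => absurd hs0 (by rw [e]; exact not_lt.2 hr)) fun hs => h s hs hs0⟩
    · exact ⟨min α r, lt_min hα hr, fun s hs hs0 => (Finset.mem_insert.1 hs).elim
        (fun e => e ▸ min_le_right _ _) fun hs => (min_le_left _ _).trans (h s hs hs0)⟩

/-! ### Daugavet-points of absolute sums -/

/-- An absolute sum for a norm with property `(α)` contains no Daugavet-points. -/
theorem AbsNorm.PropertyAlpha.not_isDaugavetPoint {N : AbsNorm} (hN : N.PropertyAlpha)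
    {X Y : Type*} [NormedAddCommGroup X] [NormedSpace ℝ X] [Nontrivial X]
    [NormedAddCommGroup Y] [NormedSpace ℝ Y] [Nontrivial Y] (z : AbsSum N X Y) :
    ¬ IsDaugavetPoint z := by
  rintro ⟨hz, hD⟩
  obtain ⟨ε, hε, W, -, hW, hmem⟩ := hN ‖z.1‖ ‖z.2‖ (norm_nonneg _) (norm_nonneg _) hz
  -- The cap 1 forces `w ≠ 0`, so `w` can be normalized; by monotonicity of `N` this keeps the norm
  -- sum above `2 - ε`.
  have key : ∀ w : AbsSum N X Y, ‖w‖ ≤ 1 → 2 - min ε 1 < ‖z - w‖ →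
      ∃ t : ℝ, 1 ≤ t ∧ (t * ‖w.1‖, t * ‖w.2‖) ∈ W := by
    intro w hw hzw
    have h1 := norm_sub_le z w
    have h2 := min_le_left ε 1
    have h3 := min_le_right ε 1
    have hw0 : 0 < ‖w‖ := by linarith
    have ht : 1 ≤ ‖w‖⁻¹ := (one_le_inv₀ hw0).2 hw
    have hle : ∀ r : ℝ, 0 ≤ r → r ≤ ‖w‖⁻¹ * r := fun r hr => le_mul_of_one_le_left hr ht
    refine ⟨‖w‖⁻¹, ht, hmem _ _ (by positivity) (by positivity) ?_ ?_⟩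
    · have h4 := N.smul_apply (inv_nonneg.2 hw0.le) (‖w.1‖, ‖w.2‖)
      rw [show N (‖w.1‖, ‖w.2‖) = ‖w‖ from rfl, inv_mul_cancel₀ hw0.ne'] at h4
      exact h4
    · have h4 : ‖z - w‖ ≤ N (‖z.1‖ + ‖w‖⁻¹ * ‖w.1‖, ‖z.2‖ + ‖w‖⁻¹ * ‖w.2‖) :=
        N.mono (norm_nonneg _)
          ((norm_sub_le z.1 w.1).trans (add_le_add_right (hle _ (norm_nonneg _)) _))
          (norm_nonneg _)
          ((norm_sub_le z.2 w.2).trans (add_le_add_right (hle _ (norm_nonneg _)) _))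
      linarith
  rcases hW with ⟨s, hs, hsW⟩ | ⟨s, hs, hsW⟩
  · obtain ⟨f, hf, -⟩ := exists_dual_vector' ℝ (0 : X)
    have hF : ‖AbsSum.coprod N f (0 : StrongDual ℝ Y)‖ = 1 := by
      refine le_antisymm (ContinuousLinearMap.opNorm_le_bound _ zero_le_one fun w => ?_) ?_
      · rw [AbsSum.coprod_apply, zero_apply, add_zero]
        exact (f.le_of_opNorm_le hf.le _).trans
          (mul_le_mul_of_nonneg_left (AbsSum.norm_fst_le w) zero_le_one)
      · rw [← hf]
        refine ContinuousLinearMap.opNorm_le_bound _ (norm_nonneg _) fun u => ?_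
        have h := (AbsSum.coprod N f (0 : StrongDual ℝ Y)).le_opNorm (AbsSum.mk N u 0)
        rw [AbsSum.norm_mk, norm_zero, N.apply_fst (norm_nonneg _), AbsSum.coprod_apply,
          zero_apply, add_zero] at h
        exact h
    obtain ⟨w, hw, hzw⟩ := (isLUB_norm_sub_slice_iff hz _ _).1
      (hD (AbsSum.coprod N f (0 : StrongDual ℝ Y)) (1 - s) (by linarith)) (min ε 1)
      (lt_min hε one_pos)
    obtain ⟨t, ht, htW⟩ := key w hw.1 hzw
    have h1 : t * ‖w.1‖ ≤ s := hsW _ htW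
    have h2 := hw.2
    rw [hF, AbsSum.coprod_apply, zero_apply, add_zero] at h2
    have h3 : ‖f w.1‖ ≤ 1 * ‖w.1‖ := f.le_of_opNorm_le hf.le _
    have h4 : f w.1 ≤ ‖f w.1‖ := le_abs_self _
    have h5 := le_mul_of_one_le_left (norm_nonneg w.1) ht
    linarith
  · obtain ⟨f, hf, -⟩ := exists_dual_vector' ℝ (0 : Y)
    have hF : ‖AbsSum.coprod N (0 : StrongDual ℝ X) f‖ = 1 := by
      refine le_antisymm (ContinuousLinearMap.opNorm_le_bound _ zero_le_one fun w => ?_) ?_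
      · rw [AbsSum.coprod_apply, zero_apply, zero_add]
        exact (f.le_of_opNorm_le hf.le _).trans
          (mul_le_mul_of_nonneg_left (AbsSum.norm_snd_le w) zero_le_one)
      · rw [← hf]
        refine ContinuousLinearMap.opNorm_le_bound _ (norm_nonneg _) fun u => ?_
        have h := (AbsSum.coprod N (0 : StrongDual ℝ X) f).le_opNorm (AbsSum.mk N 0 u)
        rw [AbsSum.norm_mk, norm_zero, N.apply_snd (norm_nonneg _), AbsSum.coprod_apply,
          zero_apply, zero_add] at h
        exact h
    obtain ⟨w, hw, hzw⟩ := (isLUB_norm_sub_slice_iff hz _ _).1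
      (hD (AbsSum.coprod N (0 : StrongDual ℝ X) f) (1 - s) (by linarith)) (min ε 1)
      (lt_min hε one_pos)
    obtain ⟨t, ht, htW⟩ := key w hw.1 hzw
    have h1 : t * ‖w.2‖ ≤ s := hsW _ htW
    have h2 := hw.2
    rw [hF, AbsSum.coprod_apply, zero_apply, zero_add] at h2
    have h3 : ‖f w.2‖ ≤ 1 * ‖w.2‖ := f.le_of_opNorm_le hf.le _
    have h4 : f w.2 ≤ ‖f w.2‖ := le_abs_self _
    have h5 := le_mul_of_one_le_left (norm_nonneg w.2) ht
    linarith

/-! ### The relative Daugavet property of absolute sums -/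

/-- Covers `x = 0` too, since a unit vector of the sum may have a zero component. -/
theorem exists_norm_eq_one_and_eq_norm_smul {X : Type*} [NormedAddCommGroup X]
    [NormedSpace ℝ X] [Nontrivial X] (x : X) : ∃ e : X, ‖e‖ = 1 ∧ x = ‖x‖ • e := by
  by_cases hx : x = 0
  · obtain ⟨e, he⟩ := exists_norm_eq X zero_le_one
    exact ⟨e, he, by simp [hx]⟩
  · refine ⟨‖x‖⁻¹ • x, norm_smul_inv_norm hx, ?_⟩
    rw [smul_smul, mul_inv_cancel₀ (norm_ne_zero_iff.2 hx), one_smul]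

/-- Scale `x - y` by the larger coefficient and correct the other term: for `a ≤ b` the bound is `b
(2 - δ) - (b - a) ≥ a + b - δ`. -/
theorem add_sub_le_norm_smul_sub_smul {X : Type*} [NormedAddCommGroup X] [NormedSpace ℝ X]
    {x y : X} {δ a b : ℝ} (hx : ‖x‖ ≤ 1) (hy : ‖y‖ ≤ 1) (hδ : 0 ≤ δ) (h : 2 - δ ≤ ‖x - y‖)
    (ha : 0 ≤ a) (ha1 : a ≤ 1) (hb : 0 ≤ b) (hb1 : b ≤ 1) :
    a + b - δ ≤ ‖a • x - b • y‖ := by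
  rcases le_total a b with hab | hab
  · have h1 : b • (x - y) = (a • x - b • y) + (b - a) • x := by module
    have h2 := norm_add_le (a • x - b • y) ((b - a) • x)
    rw [← h1, norm_smul, norm_smul, Real.norm_of_nonneg hb,
      Real.norm_of_nonneg (sub_nonneg.2 hab)] at h2
    nlinarith
  · have h1 : a • (x - y) = (a • x - b • y) + -((a - b) • y) := by module
    have h2 := norm_add_le (a • x - b • y) (-((a - b) • y))
    rw [← h1, norm_neg, norm_smul, norm_smul, Real.norm_of_nonneg ha,
      Real.norm_of_nonneg (sub_nonneg.2 hab)] at h2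
    nlinarith

/-- A slice `S(g, η)` whose multiple by `c` is almost maximal for `p • f` contains points `u` such
that `c • u` is almost antipodal to all multiples of `x`, up to the weight `p`. -/
theorem IsDaugavetRelativeTo.exists_mem_slice {X : Type*} [NormedAddCommGroup X]
    [NormedSpace ℝ X] {x : X} {f : StrongDual ℝ X} {γ : ℝ}
    (h : IsDaugavetRelativeTo x (slice f γ)) (hx : ‖x‖ = 1) (hf : ‖f‖ = 1) (hγ : 0 < γ)
    {g : StrongDual ℝ X} {η : ℝ} (hη : 0 < η) {p c α : ℝ} (hp : 0 ≤ p) (hc : 0 ≤ c) (hc1 : c ≤ 1)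
    (hα : 0 < p * c * γ → α ≤ p * c * γ) (hg : ∀ u ∈ slice g η, p * c * (1 - f u) < α)
    {δ : ℝ} (hδ : 0 < δ) :
    ∃ u ∈ slice g η, ∀ a : ℝ, 0 ≤ a → a ≤ 1 → p * (a + c - δ) ≤ p * ‖a • x - c • u‖ := by
  -- If `p * c = 0`, the slice inclusion is not available, but any `u` works: either the weight `p`
  -- vanishes or `c • u = 0`.
  rcases (mul_nonneg hp hc).eq_or_lt with h0 | hpc
  · obtain ⟨u, hu⟩ := slice_nonempty g hη
    refine ⟨u, hu, fun a ha _ => ?_⟩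
    rcases mul_eq_zero.1 h0.symm with rfl | rfl
    · rw [zero_mul, zero_mul]
    · rw [zero_smul, sub_zero, norm_smul, hx, Real.norm_of_nonneg ha]
      exact mul_le_mul_of_nonneg_left (by linarith) hp
  · have hsub : slice g η ⊆ slice f γ := by
      intro u hu
      refine ⟨hu.1, ?_⟩
      have h1 := (hg u hu).trans_le (hα (mul_pos hpc hγ))
      have h2 := lt_of_mul_lt_mul_left h1 hpc.le
      rw [hf]
      linarith
    obtain ⟨u, hu, hxu⟩ := (isLUB_norm_sub_slice_iff hx g η).1 (h g η hη hsub) δ hδ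
    exact ⟨u, hu, fun a ha ha1 => mul_le_mul_of_nonneg_left
      (add_sub_le_norm_smul_sub_smul hx.le hu.1 hδ.le hxu.le ha ha1 hc hc1) hp⟩

/-- The relative Daugavet property passes to absolute sums for polyhedral norms. -/
theorem RelativeDaugavetProperty.absSum {N : AbsNorm} (hN : N.IsPolyhedral)
    {X Y : Type*} [NormedAddCommGroup X] [NormedSpace ℝ X] [Nontrivial X]
    [NormedAddCommGroup Y] [NormedSpace ℝ Y] [Nontrivial Y]
    (hX : RelativeDaugavetProperty X) (hY : RelativeDaugavetProperty Y) :
    RelativeDaugavetProperty (AbsSum N X Y) := by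
  classical
  intro z hz
  obtain ⟨x, hx, hzx⟩ := exists_norm_eq_one_and_eq_norm_smul z.1
  obtain ⟨y, hy, hzy⟩ := exists_norm_eq_one_and_eq_norm_smul z.2
  have ha1 : ‖z.1‖ ≤ 1 := (AbsSum.norm_fst_le z).trans hz.le
  have hb1 : ‖z.2‖ ≤ 1 := (AbsSum.norm_snd_le z).trans hz.le
  obtain ⟨p, q, hp, hq, hpq, hpqN⟩ := N.exists_support (norm_nonneg z.1) (norm_nonneg z.2) hz
  set a := ‖z.1‖ with ha
  set b := ‖z.2‖ with hb
  have ha0 : 0 ≤ a := norm_nonneg _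
  have hb0 : 0 ≤ b := norm_nonneg _
  have hp1 : p ≤ 1 := by
    have := hpqN 1 0 zero_le_one le_rfl
    rw [N.apply_fst zero_le_one] at this
    linarith
  have hq1 : q ≤ 1 := by
    have := hpqN 0 1 le_rfl zero_le_one
    rw [N.apply_snd zero_le_one] at this
    linarith
  obtain ⟨-, f₁, γ₁, hf₁, hfx, hγ₁, hD₁⟩ := hX x hx
  obtain ⟨-, f₂, γ₂, hf₂, hfy, hγ₂, hD₂⟩ := hY y hy
  obtain ⟨V, hV, hVmax⟩ := hN.exists_finset_maximizers
  -- The first family forces `p c + q d = 1`; the other two force the component slices into those of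
  -- `f₁` and `f₂`.
  obtain ⟨α, hα, hαF⟩ := Finset.exists_pos_le_of_pos
    (V.image (fun w => 1 - (p * w.1 + q * w.2)) ∪
      (V.image (fun w => p * w.1 * γ₁) ∪ V.image (fun w => q * w.2 * γ₂)))
  have hle₁ : ∀ u, ‖f₁ u‖ ≤ ‖u‖ := fun u => (f₁.le_of_opNorm_le hf₁.le u).trans_eq (one_mul _)
  have hle₂ : ∀ v, ‖f₂ v‖ ≤ ‖v‖ := fun v => (f₂.le_of_opNorm_le hf₂.le v).trans_eq (one_mul _)
  set f : StrongDual ℝ (AbsSum N X Y) := AbsSum.coprod N (p • f₁) (q • f₂) with hf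
  have hf_apply : ∀ w, f w = p * f₁ w.1 + q * f₂ w.2 := fun w => rfl
  have hfz : f z = 1 := by
    rw [hf_apply, hzx, hzy, map_smul, map_smul, hfx, hfy, smul_eq_mul, smul_eq_mul, mul_one,
      mul_one, hpq]
  have hfn : ‖f‖ = 1 := by
    refine le_antisymm (ContinuousLinearMap.opNorm_le_bound _ zero_le_one fun w => ?_) ?_
    · rw [one_mul, hf_apply, Real.norm_eq_abs]
      refine (abs_add_le _ _).trans ?_
      rw [abs_mul, abs_mul, abs_of_nonneg hp, abs_of_nonneg hq]
      exact (add_le_add (mul_le_mul_of_nonneg_left (hle₁ _) hp)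
        (mul_le_mul_of_nonneg_left (hle₂ _) hq)).trans (hpqN _ _ (norm_nonneg _) (norm_nonneg _))
    · have h := f.le_opNorm z
      rwa [hfz, hz, mul_one, norm_one] at h
  refine ⟨hz, f, α, hfn, hfz, hα, fun g β hβ hsub =>
    (isLUB_norm_sub_slice_iff hz g β).2 fun δ hδ => ?_⟩
  obtain ⟨g₁, g₂, rfl⟩ := AbsSum.exists_eq_coprod g
  obtain ⟨⟨c, d⟩, hw, hwmax⟩ := hVmax ‖g₁‖ ‖g₂‖ (norm_nonneg _) (norm_nonneg _)
  obtain ⟨hc, hd, hcd⟩ := hV _ hw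
  simp only at hc hd hwmax
  have hc1 : c ≤ 1 := (le_abs_self c).trans ((N.abs_fst_le (c, d)).trans hcd)
  have hd1 : d ≤ 1 := (le_abs_self d).trans ((N.abs_snd_le (c, d)).trans hcd)
  have hnorm : ‖AbsSum.coprod N g₁ g₂‖ ≤ ‖g₁‖ * c + ‖g₂‖ * d := by
    refine (isLUB_image_closedBall (AbsSum.coprod N g₁ g₂)).2 ?_
    rintro _ ⟨w, hwB, rfl⟩
    rw [mem_closedBall_zero_iff] at hwB
    exact (add_le_add ((le_abs_self _).trans (g₁.le_opNorm w.1))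
      ((le_abs_self _).trans (g₂.le_opNorm w.2))).trans (hwmax _ _ hwB)
  -- The two components lose at most `2 β / 3` together, strictly less than `β` even when `c` or `d`
  -- is 0.
  set η := β / 3 with hη
  have hη0 : 0 < η := by positivity
  have hmem : ∀ u ∈ slice g₁ η, ∀ v ∈ slice g₂ η,
      AbsSum.mk N (c • u) (d • v) ∈ slice (AbsSum.coprod N g₁ g₂) β := by
    intro u hu v hv
    refine ⟨?_, ?_⟩
    · rw [AbsSum.norm_mk, norm_smul, norm_smul, Real.norm_of_nonneg hc, Real.norm_of_nonneg hd]
      exact (N.mono (mul_nonneg hc (norm_nonneg _)) (mul_le_of_le_one_right hc hu.1)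
        (mul_nonneg hd (norm_nonneg _)) (mul_le_of_le_one_right hd hv.1)).trans hcd
    · change _ < g₁ (c • u) + g₂ (d • v)
      rw [map_smul, map_smul, smul_eq_mul, smul_eq_mul]
      have h1 := mul_le_mul_of_nonneg_left hu.2.le hc
      have h2 := mul_le_mul_of_nonneg_left hv.2.le hd
      have h3 : c * η ≤ η := mul_le_of_le_one_left hη0.le hc1
      have h4 : d * η ≤ η := mul_le_of_le_one_left hη0.le hd1
      linarith
  have hfval : ∀ u ∈ slice g₁ η, ∀ v ∈ slice g₂ η, 1 - α < p * c * f₁ u + q * d * f₂ v := by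
    intro u hu v hv
    have h1 := (hsub (hmem u hu v hv)).2
    rw [hfn] at h1
    change 1 - α < p * f₁ (c • u) + q * f₂ (d • v) at h1
    rw [map_smul, map_smul, smul_eq_mul, smul_eq_mul] at h1
    linarith
  have hu1 : ∀ u ∈ slice g₁ η, p * c * f₁ u ≤ p * c := fun u hu =>
    mul_le_of_le_one_right (mul_nonneg hp hc) ((le_abs_self _).trans ((hle₁ u).trans hu.1))
  have hv1 : ∀ v ∈ slice g₂ η, q * d * f₂ v ≤ q * d := fun v hv =>
    mul_le_of_le_one_right (mul_nonneg hq hd) ((le_abs_self _).trans ((hle₂ v).trans hv.1))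
  obtain ⟨u₀, hu₀⟩ := slice_nonempty g₁ hη0
  obtain ⟨v₀, hv₀⟩ := slice_nonempty g₂ hη0
  have hsum_le : p * c + q * d ≤ 1 := (hpqN c d hc hd).trans hcd
  have hsum : p * c + q * d = 1 := by
    refine hsum_le.antisymm (not_lt.1 fun hlt => ?_)
    have h1 : α ≤ 1 - (p * c + q * d) := hαF _ (Finset.mem_union_left _
      (Finset.mem_image.2 ⟨(c, d), hw, rfl⟩)) (sub_pos.2 hlt)
    linarith [hfval u₀ hu₀ v₀ hv₀, hu1 u₀ hu₀, hv1 v₀ hv₀]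
  obtain ⟨u, hu, hfar₁⟩ := hD₁.exists_mem_slice hx hf₁ hγ₁ hη0 hp hc hc1
    (hαF _ (Finset.mem_union_right _ (Finset.mem_union_left _
      (Finset.mem_image.2 ⟨(c, d), hw, rfl⟩))))
    (fun u hu => by linarith [hfval u hu v₀ hv₀, hv1 v₀ hv₀]) (δ := δ / 3) (by positivity)
  obtain ⟨v, hv, hfar₂⟩ := hD₂.exists_mem_slice hy hf₂ hγ₂ hη0 hq hd hd1
    (hαF _ (Finset.mem_union_right _ (Finset.mem_union_right _
      (Finset.mem_image.2 ⟨(c, d), hw, rfl⟩))))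
    (fun v hv => by linarith [hfval u₀ hu₀ v hv, hu1 u₀ hu₀]) (δ := δ / 3) (by positivity)
  refine ⟨_, hmem u hu v hv, ?_⟩
  -- The support `(p, q)` of `N` at `(a, b)` also attains 1 at `(c, d)`, so this lower bound is at
  -- least `2 - 2 δ / 3`.
  have h1 : p * ‖a • x - c • u‖ + q * ‖b • y - d • v‖ ≤ ‖z - AbsSum.mk N (c • u) (d • v)‖ := by
    rw [← hzx, ← hzy]
    exact hpqN _ _ (norm_nonneg _) (norm_nonneg _)
  have h2 := hfar₁ a ha0 ha1
  have h3 := hfar₂ b hb0 hb1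
  have h4 : p * (δ / 3) ≤ δ / 3 := mul_le_of_le_one_left (by positivity) hp1
  have h5 : q * (δ / 3) ≤ δ / 3 := mul_le_of_le_one_left (by positivity) hq1
  linarith

theorem mainTheorem6 :
    -- a nonzero Banach space with the relative Daugavet property and without Daugavet-points
    (∃ (Z : Type) (_ : NormedAddCommGroup Z) (_ : NormedSpace ℝ Z),
      CompleteSpace Z ∧ Nontrivial Z ∧ RelativeDaugavetProperty Z ∧
        ∀ z : Z, ¬ IsDaugavetPoint z) ∧
    -- absolute sums give such spaces
    (∀ (N : AbsNorm), N.IsPolyhedral → N.PropertyAlpha →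
      ∀ (X : Type u) (Y : Type v)
        [NormedAddCommGroup X] [NormedSpace ℝ X] [CompleteSpace X] [Nontrivial X]
        [NormedAddCommGroup Y] [NormedSpace ℝ Y] [CompleteSpace Y] [Nontrivial Y],
        RelativeDaugavetProperty X → RelativeDaugavetProperty Y →
          CompleteSpace (AbsSum N X Y) ∧ RelativeDaugavetProperty (AbsSum N X Y) ∧
            ∀ z : AbsSum N X Y, ¬ IsDaugavetPoint z) ∧
    -- the relative Daugavet property holds in all spaces with the Daugavet property
    (∀ (X : Type u) [NormedAddCommGroup X] [NormedSpace ℝ X] [CompleteSpace X],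
      DaugavetProperty X → RelativeDaugavetProperty X) ∧
    -- the required norms and summands exist
    (∃ N : AbsNorm, N.IsPolyhedral ∧ N.PropertyAlpha) ∧
    (∃ (X : Type) (_ : NormedAddCommGroup X) (_ : NormedSpace ℝ X),
      CompleteSpace X ∧ Nontrivial X ∧ DaugavetProperty X) := by
  have hC : DaugavetProperty (BoundedContinuousFunction ℝ ℝ) :=
    daugavetProperty_boundedContinuousFunction
  have : Nontrivial (BoundedContinuousFunction ℝ ℝ) :=
    ⟨0, .const ℝ 1, fun h => zero_ne_one (DFunLike.congr_fun h 0)⟩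
  have hP := AbsNorm.dodecagonal_isPolyhedral
  have hA := AbsNorm.dodecagonal_propertyAlpha
  have hR := hC.relativeDaugavetProperty
  refine ⟨⟨AbsSum .dodecagonal (BoundedContinuousFunction ℝ ℝ) (BoundedContinuousFunction ℝ ℝ),
    inferInstance, inferInstance, inferInstance,
    inferInstanceAs (Nontrivial (BoundedContinuousFunction ℝ ℝ × BoundedContinuousFunction ℝ ℝ)),
    hR.absSum hP hR, hA.not_isDaugavetPoint⟩, ?_, ?_, ⟨_, hP, hA⟩,
    ⟨_, inferInstance, inferInstance, inferInstance, inferInstance, hC⟩⟩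
  · intro N hN hNA X Y _ _ _ _ _ _ _ _ hX hY
    exact ⟨inferInstance, hX.absSum hN hY, hNA.not_isDaugavetPoint⟩
  · intro X _ _ _ hX
    exact hX.relativeDaugavetProperty
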